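/- Let $D_1$ be a non-empty set, let $F_1$ be a reproducing kernel Hilbert space of real functions on $D_1$ with kernel $K_1$, let $G_1$ be a real Hilbert space, and let $S_1\colon F_1\to G_1$ be a non-zero compact linear operator. For $d\ge 1$ let $S_d=S_1^{\otimes d}\colon F_d=F_1^{\otimes d}\to G_d=G_1^{\otimes d}$ (Hilbert space tensor powers), where $F_d$ is viewed as the reproducing kernel Hilbert space of functions on $D_d=D_1^d$ with kernel $K_d(x,t)=\prod_{j=1}^d K_1(x_j,t_j)$. For a continuous linear operator $S\colon F\to G$, where $F$ is a reproducing kernel Hilbert space of real functions on $D$ and $G$ is a Hilbert space, an algorithm using at most $n$ function values is a map $A_nf=\sum_{j=1}^n f(t_j)\,g_j$ with $t_j\in D$ and $g_j\in S(F)$ (and $A_0=0$); its worst case error is $e(A_n)=\sup_{\|f\|_F\le 1}\|Sf-A_nf\|_G=\|S-A_n\|$. Let $e_n(S)=\inf_{A_n}e(A_n)$, let $e_0(S)=\|S\|$ be the initial error, and for $\varepsilon\in(0,1)$ let $$n(\varepsilon,S)=\min\{\,n:\ \exists\,A_n\ \text{with}\ e(A_n)\le\varepsilon\, e_0(S)\,\}$$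 (with $\min\emptyset=\infty$) be the information complexity for standard information $\Lambda^{\rm std}$ and the normalized error criterion. Let $\lambda_1\ge\lambda_2\ge\dots\ge 0$ be the eigenvalues, counted with multiplicity, of $W_1=S_1^*S_1\colon F_1\to F_1$ (with $\lambda_j=0$ for $j>\dim F_1$), and let $\eta_1$ be a normalized eigenfunction of $W_1$ for the eigenvalue $\lambda_1$. Assume that 1. $\lambda_2<\lambda_1$; 2. $\mathrm{decay}_e:=\sup\{\,r\ge 0:\ \lim_{n\to\infty}n^r e_n(S_1)=0\,\}>0$; 3. $\eta_1=\pm K_1(t,t)^{-1/2}K_1(\cdot,t)$ for some $t\in D_1$. Then $\{S_d\}_{d\ge1}$ is quasi-polynomially tractable for $\Lambda^{\rm std}$ in the worst case setting with the normalized error criterion: there are $C,p\ge 0$ such that $$n(\varepsilon,S_d)\le C\exp\bigl(p\,(1+\ln\varepsilon^{-1})(1+\ln d)\bigr)\qquad\text{for all }\varepsilon\in(0,1),\ d\in\{1,2,\dots\}.$$ -/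

import Mathlib

open Filter Topology

set_option linter.unusedSectionVars false

noncomputable section

/-! ## Tensor powers of real Hilbert spaces -/

section TensorPower

variable (ι : Type*) [Fintype ι] (E : Type*) [NormedAddCommGroup E] [InnerProductSpace ℝ E]

/-- The algebraic tensor power `⨂_{i : ι} E`.  It is a copy of Mathlib's `PiTensorProduct`, so that
it can carry the Hilbertian inner product instead of the projective seminorm. -/
def AlgTensorPower : Type _ := PiTensorProduct ℝ (fun _ : ι => E)

instance : AddCommGroup (AlgTensorPower ι E) :=
  inferInstanceAs (AddCommGroup (PiTensorProduct ℝ (fun _ : ι => E)))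

instance : Module ℝ (AlgTensorPower ι E) :=
  inferInstanceAs (Module ℝ (PiTensorProduct ℝ (fun _ : ι => E)))

namespace AlgTensorPower

/-- Elementary tensors. -/
def tprod : MultilinearMap ℝ (fun _ : ι => E) (AlgTensorPower ι E) :=
  PiTensorProduct.tprod ℝ

/-- Auxiliary form of `innerForm`, on `PiTensorProduct`. -/
def innerFormAux : PiTensorProduct ℝ (fun _ : ι => E) →ₗ[ℝ]
    Module.Dual ℝ (PiTensorProduct ℝ (fun _ : ι => E)) :=
  PiTensorProduct.dualDistrib ∘ₗ
    PiTensorProduct.map (fun _ : ι => (innerₗ E : E →ₗ[ℝ] Module.Dual ℝ E))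

theorem innerFormAux_tprod (x y : ι → E) :
    innerFormAux ι E (PiTensorProduct.tprod ℝ x) (PiTensorProduct.tprod ℝ y) =
      ∏ i, inner ℝ (x i) (y i) := by
  rw [innerFormAux, LinearMap.comp_apply, PiTensorProduct.map_tprod,
    PiTensorProduct.dualDistrib_apply]
  rfl

/-- The bilinear form with `⟨⨂ x_i, ⨂ y_i⟩ = ∏ ⟨x_i, y_i⟩`. -/
def innerForm : AlgTensorPower ι E →ₗ[ℝ] AlgTensorPower ι E →ₗ[ℝ] ℝ :=
  innerFormAux ι E

variable {ι E}

theorem innerForm_tprod (x y : ι → E) :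
    innerForm ι E (tprod ι E x) (tprod ι E y) = ∏ i, inner ℝ (x i) (y i) :=
  innerFormAux_tprod ι E x y

theorem exists_eq_sum (z : AlgTensorPower ι E) :
    ∃ (n : ℕ) (c : Fin n → ℝ) (x : Fin n → ι → E), z = ∑ k, c k • tprod ι E (x k) := by
  have hz : z ∈ Submodule.span ℝ (Set.range (tprod ι E)) := by
    have := PiTensorProduct.span_tprod_eq_top (R := ℝ) (s := fun _ : ι => E)
    change z ∈ Submodule.span ℝ (Set.range (PiTensorProduct.tprod ℝ))
    rw [this]; trivial
  obtain ⟨n, c, g, rfl⟩ := Submodule.mem_span_set'.1 hz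
  choose x hx using fun k => (g k).2
  exact ⟨n, c, x, by simp only [hx]⟩

theorem innerForm_sum {n : ℕ} (c : Fin n → ℝ) (x : Fin n → ι → E) :
    innerForm ι E (∑ k, c k • tprod ι E (x k)) (∑ k, c k • tprod ι E (x k)) =
      ∑ k, ∑ l, c k * c l * ∏ i, inner ℝ (x k i) (x l i) := by
  simp only [map_sum, map_smul, LinearMap.sum_apply, LinearMap.smul_apply, innerForm_tprod,
    smul_eq_mul, Finset.mul_sum, mul_assoc]
  rw [Finset.sum_comm]
  exact Finset.sum_congr rfl fun k _ => Finset.sum_congr rfl fun l _ => by ring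

theorem quadForm_nonneg {n : ℕ} {M : Matrix (Fin n) (Fin n) ℝ} (hM : M.PosSemidef)
    (c : Fin n → ℝ) : 0 ≤ ∑ k, ∑ l, c k * c l * M k l := by
  have := hM.dotProduct_mulVec_nonneg c
  simp only [dotProduct, Matrix.mulVec, Pi.star_apply, star_trivial, Finset.mul_sum] at this
  refine this.trans_eq (Finset.sum_congr rfl fun k _ => Finset.sum_congr rfl fun l _ => ?_)
  ring

/-- Schur products of Gram matrices. -/
theorem posSemidef_prod_gram {n : ℕ} (s : Finset ι) (x : Fin n → ι → E) :
    (Matrix.of fun k l => ∏ i ∈ s, inner ℝ (x k i) (x l i)).PosSemidef := by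
  classical
  induction s using Finset.induction_on with
  | empty =>
    convert Matrix.posSemidef_vecMulVec_self_star (fun _ : Fin n => (1 : ℝ)) using 1
    ext k l; simp [Matrix.vecMulVec]
  | insert a s ha ih =>
    have e : (Matrix.of fun k l => ∏ i ∈ insert a s, inner ℝ (x k i) (x l i)) =
        (Matrix.gram ℝ fun k => x k a).hadamard
          (Matrix.of fun k l => ∏ i ∈ s, inner ℝ (x k i) (x l i)) := by
      ext k l; simp [Finset.prod_insert ha]
    rw [e]
    exact (Matrix.posSemidef_gram (𝕜 := ℝ) (fun k => x k a)).hadamard ih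

theorem posSemidef_prod_gram_sub {G : Type*} [NormedAddCommGroup G] [InnerProductSpace ℝ G]
    {n : ℕ} (s : Finset ι) (T : ι → E →L[ℝ] G) (x : Fin n → ι → E) :
    (Matrix.of fun k l => (∏ i ∈ s, ‖T i‖ ^ 2 * inner ℝ (x k i) (x l i)) -
      ∏ i ∈ s, inner ℝ (T i (x k i)) (T i (x l i))).PosSemidef := by
  classical
  induction s using Finset.induction_on with
  | empty =>
    convert Matrix.PosSemidef.zero using 1
    ext k l; simp
  | insert a s ha ih =>
    have h1 := (Matrix.posSemidef_gram (𝕜 := ℝ) (fun k => ‖T a‖ • x k a)).hadamard ih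
    have hd : (Matrix.of fun k l => ‖T a‖ ^ 2 * inner ℝ (x k a) (x l a) -
        inner ℝ (T a (x k a)) (T a (x l a))).PosSemidef := by
      refine .of_dotProduct_mulVec_nonneg ?_ fun c => ?_
      · ext k l
        simp [real_inner_comm]
      · have h := (T a).le_opNorm (∑ k, c k • x k a)
        have h' := mul_self_le_mul_self (norm_nonneg _) h
        have e1 : ‖∑ k, c k • x k a‖ * ‖∑ k, c k • x k a‖ =
            ∑ k, ∑ l, c k * c l * inner ℝ (x k a) (x l a) := by
          rw [← real_inner_self_eq_norm_mul_norm]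
          simp only [sum_inner, inner_sum, inner_smul_left, inner_smul_right,
            conj_trivial, mul_assoc, Finset.mul_sum]
          rw [Finset.sum_comm]
          exact Finset.sum_congr rfl fun k _ => Finset.sum_congr rfl fun l _ => by ring
        have e2 : ‖T a (∑ k, c k • x k a)‖ * ‖T a (∑ k, c k • x k a)‖ =
            ∑ k, ∑ l, c k * c l * inner ℝ (T a (x k a)) (T a (x l a)) := by
          rw [← real_inner_self_eq_norm_mul_norm]
          simp only [map_sum, map_smul, sum_inner, inner_sum, inner_smul_left, inner_smul_right,
            conj_trivial, mul_assoc, Finset.mul_sum]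
          rw [Finset.sum_comm]
          exact Finset.sum_congr rfl fun k _ => Finset.sum_congr rfl fun l _ => by ring
        have e3 : (‖T a‖ * ‖∑ k, c k • x k a‖) * (‖T a‖ * ‖∑ k, c k • x k a‖) =
            ∑ k, ∑ l, c k * c l * (‖T a‖ ^ 2 * inner ℝ (x k a) (x l a)) := by
          rw [mul_mul_mul_comm, e1]
          simp only [Finset.mul_sum]
          exact Finset.sum_congr rfl fun k _ => Finset.sum_congr rfl fun l _ => by ring
        rw [e2, e3] at h'
        have h2 := sub_nonneg.2 h'
        rw [← Finset.sum_sub_distrib] at h2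
        simp only [dotProduct, Matrix.mulVec, Pi.star_apply, star_trivial, Finset.mul_sum]
        convert h2 using 2 with k
        rw [← Finset.sum_sub_distrib]
        refine Finset.sum_congr rfl fun l _ => ?_
        simp only [Matrix.of_apply]
        ring
    have h2 := hd.hadamard (posSemidef_prod_gram s fun k i => T i (x k i))
    have h3 := h1.add h2
    have e : (Matrix.of fun k l =>
        (∏ i ∈ insert a s, ‖T i‖ ^ 2 * inner ℝ (x k i) (x l i)) -
          ∏ i ∈ insert a s, inner ℝ (T i (x k i)) (T i (x l i))) =
        (Matrix.gram ℝ fun k => ‖T a‖ • x k a).hadamard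
          (Matrix.of fun k l => (∏ i ∈ s, ‖T i‖ ^ 2 * inner ℝ (x k i) (x l i)) -
            ∏ i ∈ s, inner ℝ (T i (x k i)) (T i (x l i))) +
        (Matrix.of fun k l => ‖T a‖ ^ 2 * inner ℝ (x k a) (x l a) -
          inner ℝ (T a (x k a)) (T a (x l a))).hadamard
          (Matrix.of fun k l => ∏ i ∈ s, inner ℝ (T i (x k i)) (T i (x l i))) := by
      ext k l
      simp only [Matrix.of_apply, Finset.prod_insert ha, Matrix.add_apply, Matrix.hadamard_apply,
        Matrix.gram_apply, inner_smul_left, inner_smul_right, conj_trivial]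
      ring
    rw [e]
    exact h3

theorem innerForm_self_nonneg (z : AlgTensorPower ι E) : 0 ≤ innerForm ι E z z := by
  obtain ⟨n, c, x, rfl⟩ := exists_eq_sum z
  rw [innerForm_sum]
  exact quadForm_nonneg (posSemidef_prod_gram Finset.univ x) c

theorem innerForm_comm (z w : AlgTensorPower ι E) : innerForm ι E z w = innerForm ι E w z := by
  obtain ⟨n, c, x, rfl⟩ := exists_eq_sum z
  obtain ⟨m, b, y, rfl⟩ := exists_eq_sum w
  simp only [map_sum, map_smul, LinearMap.sum_apply, LinearMap.smul_apply, innerForm_tprod,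
    smul_eq_mul, Finset.mul_sum]
  rw [Finset.sum_comm]
  refine Finset.sum_congr rfl fun k _ => Finset.sum_congr rfl fun l _ => ?_
  simp only [real_inner_comm (y _ _) (x _ _)]
  ring

instance : PreInnerProductSpace.Core ℝ (AlgTensorPower ι E) where
  inner z w := innerForm ι E z w
  conj_inner_symm z w := by simpa using innerForm_comm w z
  re_inner_nonneg z := by simpa using innerForm_self_nonneg z
  add_left _ _ _ := by simp
  smul_left _ _ _ := by simp

instance : SeminormedAddCommGroup (AlgTensorPower ι E) :=
  InnerProductSpace.Core.toSeminormedAddCommGroup (𝕜 := ℝ)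

instance : InnerProductSpace ℝ (AlgTensorPower ι E) := .ofCore _

theorem inner_def (z w : AlgTensorPower ι E) : inner ℝ z w = innerForm ι E z w := rfl

theorem inner_tprod (x y : ι → E) :
    inner ℝ (tprod ι E x) (tprod ι E y) = ∏ i, inner ℝ (x i) (y i) := innerForm_tprod x y

variable {G : Type*} [NormedAddCommGroup G] [InnerProductSpace ℝ G]

/-- The linear map `⨂ T_i` on algebraic tensors. -/
def mapₗ (T : ι → E →L[ℝ] G) : AlgTensorPower ι E →ₗ[ℝ] AlgTensorPower ι G :=
  PiTensorProduct.map (fun i => (T i : E →ₗ[ℝ] G))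

theorem mapₗ_tprod (T : ι → E →L[ℝ] G) (x : ι → E) :
    mapₗ T (tprod ι E x) = tprod ι G (fun i => T i (x i)) :=
  PiTensorProduct.map_tprod (fun i => (T i : E →ₗ[ℝ] G)) x

theorem norm_mapₗ_le (T : ι → E →L[ℝ] G) (z : AlgTensorPower ι E) :
    ‖mapₗ T z‖ ≤ (∏ i, ‖T i‖) * ‖z‖ := by
  refine le_of_sq_le_sq ?_ (by positivity)
  rw [mul_pow, ← real_inner_self_eq_norm_sq, ← real_inner_self_eq_norm_sq, inner_def, inner_def]
  obtain ⟨n, c, x, rfl⟩ := exists_eq_sum z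
  have h := quadForm_nonneg (posSemidef_prod_gram_sub Finset.univ T x) c
  have e : mapₗ T (∑ k, c k • tprod ι E (x k)) =
      ∑ k, c k • tprod ι G (fun i => T i (x k i)) := by
    rw [map_sum]
    exact Finset.sum_congr rfl fun k _ => by rw [map_smul, mapₗ_tprod]
  rw [e]
  rw [innerForm_sum, innerForm_sum]
  rw [← sub_nonneg]
  refine h.trans_eq ?_
  simp only [Finset.mul_sum, ← Finset.sum_sub_distrib]
  refine Finset.sum_congr rfl fun k _ => Finset.sum_congr rfl fun l _ => ?_
  simp only [Matrix.of_apply, Finset.prod_mul_distrib, Finset.prod_pow]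
  ring

/-- The continuous linear map `⨂ T_i` on algebraic tensors. -/
def map (T : ι → E →L[ℝ] G) : AlgTensorPower ι E →L[ℝ] AlgTensorPower ι G :=
  (mapₗ T).mkContinuous (∏ i, ‖T i‖) (norm_mapₗ_le T)

end AlgTensorPower

/-- The Hilbert space tensor power `E ⊗ ⋯ ⊗ E` (one factor for each `i : ι`): the completion of the
algebraic tensor power for the inner product `⟨⨂ x_i, ⨂ y_i⟩ = ∏ ⟨x_i, y_i⟩`. -/
abbrev HilbertTensorPower : Type _ := UniformSpace.Completion (AlgTensorPower ι E)

namespace HilbertTensorPower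

variable {ι E}

/-- The elementary tensor `⨂ x_i`. -/
def tprod (x : ι → E) : HilbertTensorPower ι E := (AlgTensorPower.tprod ι E x : AlgTensorPower ι E)

theorem inner_tprod (x y : ι → E) :
    inner ℝ (tprod x) (tprod y) = ∏ i, inner ℝ (x i) (y i) := by
  rw [tprod, tprod, UniformSpace.Completion.inner_coe, AlgTensorPower.inner_tprod]

theorem ext_inner {f : HilbertTensorPower ι E} (h : ∀ x : ι → E, inner ℝ (tprod x) f = 0) :
    f = 0 := by
  refine UniformSpace.Completion.denseRange_coe.eq_zero_of_inner_right ℝ fun z => ?_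
  obtain ⟨n, c, x, rfl⟩ := AlgTensorPower.exists_eq_sum z
  rw [← UniformSpace.Completion.coe_toComplL (𝕜 := ℝ)]
  simp only [map_sum, map_smul, sum_inner, inner_smul_left]
  refine Finset.sum_eq_zero fun k _ => ?_
  have := h (x k)
  rw [tprod] at this
  simp [this]

variable {G : Type*} [NormedAddCommGroup G] [InnerProductSpace ℝ G]

/-- The continuous linear operator `⨂ T_i`. -/
def map (T : ι → E →L[ℝ] G) : HilbertTensorPower ι E →L[ℝ] HilbertTensorPower ι G :=
  (AlgTensorPower.map T).completion

theorem map_tprod (T : ι → E →L[ℝ] G) (x : ι → E) :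
    map T (tprod x) = tprod (fun i => T i (x i)) := by
  rw [map, tprod, ContinuousLinearMap.completion_apply_coe]
  exact congrArg _ (AlgTensorPower.mapₗ_tprod T x)

end HilbertTensorPower

end TensorPower

/-! ## Function values -/

section Evaluation

variable {H X : Type*} [NormedAddCommGroup H] [InnerProductSpace ℝ H] [RKHS ℝ H X ℝ]

/-- The evaluation functional `f ↦ f x`. -/
def evalCLM (H : Type*) [NormedAddCommGroup H] [InnerProductSpace ℝ H] [RKHS ℝ H X ℝ] (x : X) :
    H →L[ℝ] ℝ :=
  ContinuousLinearMap.proj x ∘L RKHS.coeCLM ℝ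

theorem evalCLM_apply (x : X) (f : H) : evalCLM H x f = f x := rfl

variable [CompleteSpace H]

/-- The function `K(·, t)`, for `K` the reproducing kernel of `H`. -/
def kernelSection (H : Type*) [NormedAddCommGroup H] [InnerProductSpace ℝ H] [RKHS ℝ H X ℝ]
    [CompleteSpace H] (t : X) : H := RKHS.kerFun H t (1 : ℝ)

/-- The real-valued reproducing kernel `K(x, t)` of `H`. -/
def reproKernel (H : Type*) [NormedAddCommGroup H] [InnerProductSpace ℝ H] [RKHS ℝ H X ℝ]
    [CompleteSpace H] (x t : X) : ℝ := kernelSection H t x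

theorem inner_kernelSection (t : X) (f : H) : inner ℝ (kernelSection H t) f = f t := by
  simp [kernelSection]

theorem eq_zero_of_inner_kernelSection (φ : H →L[ℝ] ℝ) (h : ∀ t, φ (kernelSection H t) = 0) :
    φ = 0 := by
  obtain ⟨f, rfl⟩ := (InnerProductSpace.toDual ℝ H).surjective φ
  have : f = 0 := RKHS.ext fun t => by
    have := h t
    rw [InnerProductSpace.toDual_apply_apply, real_inner_comm, inner_kernelSection] at this
    simpa using this
  simp [this]

namespace HilbertTensorPower

variable {ι : Type*} [Fintype ι]

theorem eq_zero_of_inner_kernelSection (f : HilbertTensorPower ι H)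
    (h : ∀ x : ι → X, inner ℝ (tprod fun i => kernelSection H (x i)) f = 0) : f = 0 := by
  classical
  have key : ∀ (s : Finset ι) (m : ι → H), (∀ i ∉ s, ∃ t, m i = kernelSection H t) →
      inner ℝ (tprod m) f = 0 := by
    intro s
    induction s using Finset.induction_on with
    | empty =>
      intro m hm
      choose x hx using fun i => hm i (by simp)
      rw [show m = fun i => kernelSection H (x i) from funext hx]
      exact h x
    | insert a s ha ih =>
      intro m hm
      let L : H →ₗ[ℝ] HilbertTensorPower ι H :=
        (UniformSpace.Completion.toComplL (𝕜 := ℝ) (E := AlgTensorPower ι H)).toLinearMap ∘ₗ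
          (AlgTensorPower.tprod ι H).toLinearMap m a
      have hL : ∀ y, L y = tprod (Function.update m a y) := fun y => rfl
      have hb : ∀ y, ‖L y‖ ≤ (∏ i ∈ Finset.univ.erase a, ‖m i‖) * ‖y‖ := by
        intro y
        refine le_of_sq_le_sq ?_ (by positivity)
        rw [← real_inner_self_eq_norm_sq, hL, inner_tprod,
          ← Finset.prod_erase_mul _ _ (Finset.mem_univ a), mul_pow, ← Finset.prod_pow]
        simp only [Function.update_self, real_inner_self_eq_norm_sq]
        refine le_of_eq (congrArg (· * ‖y‖ ^ 2) (Finset.prod_congr rfl fun i hi => ?_))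
        rw [Function.update_of_ne (Finset.ne_of_mem_erase hi)]
      let φ : H →L[ℝ] ℝ := innerSL ℝ f ∘L L.mkContinuous _ hb
      have hφ : ∀ y, φ y = inner ℝ (tprod (Function.update m a y)) f := fun y => by
        rw [← hL, real_inner_comm]; rfl
      have h0 : φ = 0 := _root_.eq_zero_of_inner_kernelSection φ fun t => by
        rw [hφ]
        refine ih _ fun i hi => ?_
        by_cases hia : i = a
        · subst hia; exact ⟨t, by simp⟩
        · rw [Function.update_of_ne hia]
          exact hm i (by simp [hia, hi])
      have := hφ (m a)
      rw [h0, Function.update_eq_self] at this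
      simpa using this.symm
  exact ext_inner fun x => key Finset.univ x (by simp)

/-- The tensor power of a reproducing kernel Hilbert space of functions on `X` is a reproducing
kernel Hilbert space of functions on `ι → X`: an element `f` is the function
`x ↦ ⟨⨂ K(·, x_i), f⟩`. -/
instance : RKHS ℝ (HilbertTensorPower ι H) (ι → X) ℝ where
  coeCLM := ContinuousLinearMap.pi fun x => innerSL ℝ (tprod fun i => kernelSection H (x i))
  coeCLM_injective := by
    refine (injective_iff_map_eq_zero _).mpr fun f hf => ?_
    exact eq_zero_of_inner_kernelSection f fun x => congrFun hf x

theorem coe_apply (f : HilbertTensorPower ι H) (x : ι → X) :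
    f x = inner ℝ (tprod fun i => kernelSection H (x i)) f := rfl

/-- Elementary tensors are products of functions. -/
theorem tprod_apply (f : ι → H) (x : ι → X) : (tprod f) x = ∏ i, f i (x i) := by
  simp [coe_apply, inner_tprod, inner_kernelSection]

theorem kernelSection_eq (x : ι → X) :
    kernelSection (HilbertTensorPower ι H) x = tprod fun i => kernelSection H (x i) :=
  ext_inner_right ℝ fun f => by rw [inner_kernelSection, coe_apply]

/-- The reproducing kernel of the tensor power is the product kernel. -/
theorem reproKernel_eq (x t : ι → X) :
    reproKernel (HilbertTensorPower ι H) x t = ∏ i, reproKernel H (x i) (t i) := by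
  rw [reproKernel, kernelSection_eq, tprod_apply]; rfl

end HilbertTensorPower

end Evaluation

/-! ## Algorithms using function values, minimal errors and information complexity -/

section Complexity

variable {H G X : Type*} [NormedAddCommGroup H] [InnerProductSpace ℝ H] [RKHS ℝ H X ℝ]
  [NormedAddCommGroup G] [InnerProductSpace ℝ G]

/-- The algorithm `f ↦ ∑ j, f (t j) • g j`. -/
def sampling (H : Type*) [NormedAddCommGroup H] [InnerProductSpace ℝ H] [RKHS ℝ H X ℝ]
    {n : ℕ} (t : Fin n → X) (g : Fin n → G) : H →L[ℝ] G :=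
  ∑ j, (evalCLM H (t j)).smulRight (g j)

theorem sampling_apply {n : ℕ} (t : Fin n → X) (g : Fin n → G) (f : H) :
    sampling H t g f = ∑ j, f (t j) • g j := by
  simp [sampling, evalCLM_apply]

/-- The algorithms for the approximation of `S` that use at most `n` function values:
`A f = ∑ j, f (t j) • g j` with sample points `t j` and with `g j` in the range of `S`.
(Sample points may be repeated and `g j` may be zero.) -/
def stdAlgorithms (S : H →L[ℝ] G) (n : ℕ) : Set (H →L[ℝ] G) :=
  {A | ∃ (t : Fin n → X) (g : Fin n → G), (∀ j, g j ∈ Set.range S) ∧ A = sampling H t g}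

/-- The worst case error `‖S - A‖ = sup_{‖f‖ ≤ 1} ‖S f - A f‖` of an algorithm `A`. -/
def worstCaseError (S A : H →L[ℝ] G) : ℝ := ‖S - A‖

/-- The initial error `e_0(S) = ‖S‖`, the error of the zero algorithm. -/
def initialError (S : H →L[ℝ] G) : ℝ := worstCaseError S 0

/-- The `n`-th minimal worst case error `e_n(S)`: the infimum of the errors of all algorithms that
use at most `n` function values. -/
def minimalError (S : H →L[ℝ] G) (n : ℕ) : ℝ := sInf (worstCaseError S '' stdAlgorithms S n)

/-- The information complexity `n(ε, S)` for function values and the normalized error criterion: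
the least `n` for which some algorithm using at most `n` function values has error at most
`ε * e_0(S)` (and `⊤` if there is no such `n`). -/
def infoComplexity (ε : ℝ) (S : H →L[ℝ] G) : ℕ∞ :=
  ⨅ (n : ℕ) (_ : ∃ A ∈ stdAlgorithms S n, worstCaseError S A ≤ ε * initialError S), (n : ℕ∞)

/-- Polynomial decay of a real sequence: `sup {r ≥ 0 : lim n ^ r * a n = 0}`, possibly infinite. -/
def polyDecay (a : ℕ → ℝ) : ENNReal :=
  ⨆ (r : NNReal) (_ : Tendsto (fun n : ℕ => (n : ℝ) ^ (r : ℝ) * a n) atTop (𝓝 0)), (r : ENNReal)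

end Complexity

/-- Quasi-polynomial tractability for function values, in the worst case setting with the normalized
error criterion, of a sequence of problems `S d : H d → G d`, `d = 1, 2, …` (`S 0` is ignored). -/
def IsQuasiPolynomiallyTractable {H G X : ℕ → Type*}
    [∀ d, NormedAddCommGroup (H d)] [∀ d, InnerProductSpace ℝ (H d)] [∀ d, RKHS ℝ (H d) (X d) ℝ]
    [∀ d, NormedAddCommGroup (G d)] [∀ d, InnerProductSpace ℝ (G d)]
    (S : ∀ d, H d →L[ℝ] G d) : Prop :=
  ∃ C t : ℝ, 0 ≤ C ∧ 0 ≤ t ∧ ∀ ε ∈ Set.Ioo (0 : ℝ) 1, ∀ d : ℕ, 1 ≤ d →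
    (infoComplexity ε (S d) : ENNReal) ≤
      ENNReal.ofReal (C * Real.exp (t * (1 + Real.log ε⁻¹) * (1 + Real.log d)))

/-! ## Linear tensor product problems -/

section Problem

variable {F G : Type*} [NormedAddCommGroup F] [InnerProductSpace ℝ F]
  [NormedAddCommGroup G] [InnerProductSpace ℝ G]

/-- The operator `S_d = S₁ ⊗ ⋯ ⊗ S₁` (`d` factors). -/
def tensorPowerOp (S : F →L[ℝ] G) (d : ℕ) :
    HilbertTensorPower (Fin d) F →L[ℝ] HilbertTensorPower (Fin d) G :=
  HilbertTensorPower.map fun _ => S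

/-- For a compact positive self-adjoint operator `W`, the `j`-th largest eigenvalue (`j = 1, 2, …`),
counted with multiplicity: the largest `μ` for which there are `j` orthonormal eigenvectors whose
eigenvalues are all at least `μ`.  It is `0` if the space has dimension less than `j`. -/
def orderedEigenvalue (W : F →L[ℝ] F) (j : ℕ) : ℝ :=
  sSup {μ : ℝ | ∃ (v : Fin j → F) (c : Fin j → ℝ),
    Orthonormal ℝ v ∧ (∀ i, W (v i) = c i • v i) ∧ ∀ i, μ ≤ c i}

end Problem

end

noncomputable section

/-! ## Calculus of tensor powers of operators -/

namespace HilbertTensorPower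

variable {ι : Type*} [Fintype ι] {E G V : Type*} [NormedAddCommGroup E] [InnerProductSpace ℝ E]
  [NormedAddCommGroup G] [InnerProductSpace ℝ G] [NormedAddCommGroup V] [NormedSpace ℝ V]

/-! Since `η₁` is a multiple of a kernel section, the projection `P` onto its line reads a single
function value: `P f` is a multiple of `f t` times `η₁`. So the part of `S₁` along `η₁`, which
dominates the tensor powers, is computed exactly with one sample. The spectral gap makes the rest,
`S' = S₁ ∘L (1 - P)`, strictly smaller: `σ = ‖S'‖ < s = ‖S₁‖` (`spectral_gap`).

Write `S₁ = ∑ Δ k` with `Δ 0 = S₁ ∘L P` and the later `Δ k` telescoping approximations of `S'` that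
vanish on `η₁` and map into the complement of `S₁ η₁`. Polynomial decay gives blocks of cost at most
`c ^ k` with errors so small that `∑_{k ≥ 1} ρ ^ k * ‖Δ k‖ ≤ s` for some `ρ > 1` (`exists_blocks`).

Expand the tensor power and keep the multi-indices with `∑ k i ≤ Q`. Grouped by the support of the
multi-index, the discarded terms act between mutually orthogonal subspaces, so their norm is
governed by the worst of the `2 ^ d` supports instead of the sum over them. Each support contributes
at most `s ^ d / ρ ^ Q` (`norm_smolyak_tail_le`), and `s ^ d ≤ ‖S_d‖`. The normalized error is thus
at most `ρ ^ (-Q)`, uniformly in `d`, while the cost is at most `e * (2 * c * d) ^ Q`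
(`sum_pow_le_of_sum_le`). Taking `Q` of order `ln ε⁻¹` gives the bound. -/

theorem clm_ext {A B : HilbertTensorPower ι E →L[ℝ] V} (h : ∀ x, A (tprod x) = B (tprod x)) :
    A = B := by
  ext f
  induction f using UniformSpace.Completion.induction_on with
  | hp => exact isClosed_eq A.continuous B.continuous
  | ih z =>
    obtain ⟨n, c, x, rfl⟩ := AlgTensorPower.exists_eq_sum z
    rw [← UniformSpace.Completion.coe_toComplL (𝕜 := ℝ)]
    simp only [map_sum, map_smul]
    exact Finset.sum_congr rfl fun k _ => congrArg (c k • ·) (h (x k))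

theorem norm_map_le (T : ι → E →L[ℝ] G) : ‖map T‖ ≤ ∏ i, ‖T i‖ := by
  refine ContinuousLinearMap.opNorm_le_bound _ (by positivity) fun f => ?_
  induction f using UniformSpace.Completion.induction_on with
  | hp => exact isClosed_le (by fun_prop) (by fun_prop)
  | ih z =>
    rw [map, ContinuousLinearMap.completion_apply_coe, UniformSpace.Completion.norm_coe,
      UniformSpace.Completion.norm_coe]
    exact AlgTensorPower.norm_mapₗ_le T z

theorem norm_sum_map_le {κ : Type*} (s : Finset κ) (T : κ → ι → E →L[ℝ] G) :
    ‖∑ k ∈ s, map (T k)‖ ≤ ∑ k ∈ s, ∏ i, ‖T k i‖ := by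
  classical
  induction s using Finset.induction_on with
  | empty => exact ContinuousLinearMap.opNorm_zero.le
  | insert a s ha ih =>
    rw [Finset.sum_insert ha, Finset.sum_insert ha]
    exact (ContinuousLinearMap.opNorm_add_le _ _).trans (add_le_add (norm_map_le _) ih)

theorem norm_tprod (x : ι → E) : ‖tprod x‖ = ∏ i, ‖x i‖ := by
  refine (sq_eq_sq₀ (norm_nonneg _) (by positivity)).1 ?_
  rw [← real_inner_self_eq_norm_sq, inner_tprod, ← Finset.prod_pow]
  simp only [real_inner_self_eq_norm_sq]

variable (ι E) in
/-- `tprod` as a multilinear map. -/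
def tprodMultilinear : MultilinearMap ℝ (fun _ : ι => E) (HilbertTensorPower ι E) :=
  (UniformSpace.Completion.toComplL (𝕜 := ℝ)
    (E := AlgTensorPower ι E)).toLinearMap.compMultilinearMap (AlgTensorPower.tprod ι E)

theorem tprodMultilinear_apply (x : ι → E) : tprodMultilinear ι E x = tprod x := rfl

theorem update_apply_eq [DecidableEq ι] (T : ι → E →L[ℝ] G) (j : ι) (A : E →L[ℝ] G) (x : ι → E) :
    (fun i => Function.update T j A i (x i)) =
      Function.update (fun i => T i (x i)) j (A (x j)) := by
  funext i
  by_cases h : i = j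
  · subst h; simp
  · simp [h]

variable (ι E G) in
/-- `map` as a multilinear map. -/
def mapMultilinear : MultilinearMap ℝ (fun _ : ι => E →L[ℝ] G)
    (HilbertTensorPower ι E →L[ℝ] HilbertTensorPower ι G) where
  toFun := map
  map_update_add' T j A B := by
    refine clm_ext fun x => ?_
    simp only [add_apply, map_tprod, update_apply_eq]
    exact (tprodMultilinear ι G).map_update_add _ j _ _
  map_update_smul' T j c A := by
    refine clm_ext fun x => ?_
    simp only [smul_apply, map_tprod, update_apply_eq]
    exact (tprodMultilinear ι G).map_update_smul _ j _ _

theorem mapMultilinear_apply (T : ι → E →L[ℝ] G) : mapMultilinear ι E G T = map T := rfl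

theorem map_comp_map {G' : Type*} [NormedAddCommGroup G'] [InnerProductSpace ℝ G']
    (T : ι → G →L[ℝ] G') (T' : ι → E →L[ℝ] G) :
    map T ∘L map T' = map fun i => T i ∘L T' i :=
  clm_ext fun x => by simp [map_tprod]

theorem map_eq_zero {T : ι → E →L[ℝ] G} {i : ι} (h : T i = 0) : map T = 0 := by
  rw [← mapMultilinear_apply]
  exact MultilinearMap.map_coord_zero _ i h

/-- On elementary tensors the inner product is a product with a zero factor at `i`. Density extends
this in one argument at a time. -/
theorem inner_map_map_eq_zero {T T' : ι → E →L[ℝ] G} {i : ι}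
    (h : ∀ x y, inner ℝ (T i x) (T' i y) = 0) (f g : HilbertTensorPower ι E) :
    inner ℝ (map T f) (map T' g) = 0 := by
  have h1 : ∀ x : ι → E, innerSL ℝ (map T (tprod x)) ∘L map T' = 0 := fun x =>
    clm_ext fun y => by
      simp only [ContinuousLinearMap.comp_apply, innerSL_apply_apply, map_tprod, inner_tprod,
        zero_apply]
      exact Finset.prod_eq_zero (Finset.mem_univ i) (h _ _)
  have h2 : innerSL ℝ (map T' g) ∘L map T = 0 := clm_ext fun x => by
    simpa [real_inner_comm] using congrArg (fun A => A g) (h1 x)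
  simpa [real_inner_comm] using congrArg (fun A => A f) h2

/-! ### Orthogonal decomposition of the tensor power along `P` and `1 - P` -/

variable [DecidableEq ι]

/-- The component operator `⨂_{i ∈ u} (1 - P) ⊗ ⨂_{i ∉ u} P`. -/
def component (P : E →L[ℝ] E) (u : Finset ι) :
    HilbertTensorPower ι E →L[ℝ] HilbertTensorPower ι E :=
  map (u.piecewise (fun _ => 1 - P) fun _ => P)

/-- This is the multilinear expansion of `⨂ ((1 - P) + P)` over subsets. -/
theorem sum_component (P : E →L[ℝ] E) : ∑ u : Finset ι, component P u = 1 := by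
  have := (mapMultilinear ι E E).map_add_univ (fun _ => 1 - P) (fun _ => P)
  simp only [mapMultilinear_apply] at this
  simp only [component, ← this]
  exact clm_ext fun x => by simp [map_tprod]

theorem inner_component {P : E →L[ℝ] E} (hP : ∀ x y, inner ℝ (P x) (y - P y) = 0)
    {u v : Finset ι} (huv : u ≠ v) (f g : HilbertTensorPower ι E) :
    inner ℝ (component P u f) (component P v g) = 0 := by
  obtain ⟨i, hi⟩ : ∃ i, ¬(i ∈ u ↔ i ∈ v) := by
    by_contra! h
    exact huv (Finset.ext h)
  refine inner_map_map_eq_zero (i := i) (fun x y => ?_) f g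
  by_cases hu : i ∈ u <;> by_cases hv : i ∈ v <;> simp [hu, hv] at hi ⊢
  · rw [real_inner_comm]; exact hP y x
  · exact hP x y

theorem sum_norm_sq_component {P : E →L[ℝ] E} (hP : ∀ x y, inner ℝ (P x) (y - P y) = 0)
    (f : HilbertTensorPower ι E) : ∑ u : Finset ι, ‖component P u f‖ ^ 2 = ‖f‖ ^ 2 := by
  have hf : f = ∑ u : Finset ι, component P u f := by
    rw [← sum_apply, sum_component]; rfl
  conv_rhs => rw [hf, ← real_inner_self_eq_norm_sq]
  simp only [sum_inner, inner_sum]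
  refine Finset.sum_congr rfl fun u _ => ?_
  rw [Finset.sum_eq_single u (fun v _ hv => inner_component hP hv f f) (by simp),
    real_inner_self_eq_norm_sq]

/-- The tail of a Smolyak expansion: if `Δ 0` lives on the range of `P` and the other `Δ k` on the
range of `1 - P`, the components of the tail do not interact and the error bound does not depend
on the number of factors except through `s ^ card ι`. -/
theorem norm_smolyak_tail_le {P : E →L[ℝ] E} {P' : G →L[ℝ] G}
    (hP : ∀ x y, inner ℝ (P x) (y - P y) = 0) (hP' : ∀ x y, inner ℝ (P' x) (y - P' y) = 0)
    {Δ : ℕ → E →L[ℝ] G} {N : ℕ} (h0 : P' ∘L Δ 0 = Δ 0) (h0' : Δ 0 ∘L P = Δ 0)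
    (hk : ∀ k ≠ 0, P' ∘L Δ k = 0) (hk' : ∀ k ≠ 0, Δ k ∘L P = 0)
    {s ρ : ℝ} (hρ : 1 ≤ ρ) (hs : ‖Δ 0‖ ≤ s) (hs' : ∑ k ∈ Finset.Ico 1 N, ρ ^ k * ‖Δ k‖ ≤ s)
    (Q : ℕ) :
    ‖∑ k ∈ Fintype.piFinset (fun _ : ι => Finset.range N) with Q < ∑ i, k i,
      map (fun i => Δ (k i))‖ * ρ ^ Q ≤ s ^ Fintype.card ι := by
  set B := (Fintype.piFinset (fun _ : ι => Finset.range N)).filter fun k => Q < ∑ i, k i with hB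
  have hρ0 : 0 < ρ := one_pos.trans_le hρ
  have hs0 : 0 ≤ s := (norm_nonneg _).trans hs
  let supp : (ι → ℕ) → Finset ι := fun k => Finset.univ.filter fun i => k i ≠ 0
  let R : Finset ι → HilbertTensorPower ι E →L[ℝ] HilbertTensorPower ι G := fun u =>
    ∑ k ∈ B with supp k = u, map (fun i => Δ (k i))
  -- Every discarded `k` has `Q < ∑ k i`, so `ρ ^ Q ≤ ∏ ρ ^ k i`. With the support fixed, the
  -- enlarged weighted sum factors over coordinates, and each factor is at most `s`.
  have hR : ∀ u, ‖R u‖ * ρ ^ Q ≤ s ^ Fintype.card ι := by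
    intro u
    have hsub : (B.filter fun k => supp k = u) ⊆
        Fintype.piFinset fun i => if i ∈ u then Finset.Ico 1 N else {0} := by
      intro k hk
      simp only [hB, Finset.mem_filter, Fintype.mem_piFinset, Finset.mem_range] at hk
      rw [Fintype.mem_piFinset]
      intro i
      rw [← hk.2]
      by_cases hi : k i = 0
      · simp [supp, hi]
      · simp only [supp, Finset.mem_filter, Finset.mem_univ, true_and, ne_eq, hi,
          not_false_eq_true, if_true, Finset.mem_Ico]
        exact ⟨Nat.pos_of_ne_zero hi, hk.1.1 i⟩
    calc ‖R u‖ * ρ ^ Q ≤ (∑ k ∈ B with supp k = u, ∏ i, ‖Δ (k i)‖) * ρ ^ Q := by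
          refine mul_le_mul_of_nonneg_right ?_ (by positivity)
          exact norm_sum_map_le (B.filter fun k => supp k = u) fun k i => Δ (k i)
      _ = ∑ k ∈ B with supp k = u, (∏ i, ‖Δ (k i)‖) * ρ ^ Q := Finset.sum_mul ..
      _ ≤ ∑ k ∈ B with supp k = u, ∏ i, ρ ^ k i * ‖Δ (k i)‖ := by
          refine Finset.sum_le_sum fun k hk => ?_
          rw [Finset.prod_mul_distrib, mul_comm, Finset.prod_pow_eq_pow_sum]
          simp only [hB, Finset.mem_filter] at hk
          have := hk.1.2.le
          gcongr
      _ ≤ ∑ k ∈ Fintype.piFinset fun i => if i ∈ u then Finset.Ico 1 N else {0},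
            ∏ i, ρ ^ k i * ‖Δ (k i)‖ :=
          Finset.sum_le_sum_of_subset_of_nonneg hsub fun k _ _ => by positivity
      _ = ∏ i, ∑ k ∈ if i ∈ u then Finset.Ico 1 N else {0}, ρ ^ k * ‖Δ k‖ :=
          (Finset.prod_univ_sum (fun i => if i ∈ u then Finset.Ico 1 N else {0})
            fun _ k => ρ ^ k * ‖Δ k‖).symm
      _ ≤ ∏ _i : ι, s := by
          refine Finset.prod_le_prod (fun i _ => Finset.sum_nonneg fun k _ => by positivity)
            fun i _ => ?_
          split_ifs
          · exact hs'
          · simpa using hs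
      _ = s ^ Fintype.card ι := by simp
  -- `component P' u` kills the summands whose support is not `u`; those with support `u` are
  -- unchanged by composition with it or with `component P u`.
  have hcomp : ∀ u f, component P' u ((∑ k ∈ B, map (fun i => Δ (k i))) f) =
      R u (component P u f) := by
    intro u f
    rw [← ContinuousLinearMap.comp_apply, ← ContinuousLinearMap.comp_apply]
    congr 1
    simp only [R, ContinuousLinearMap.comp_finsetSum, ContinuousLinearMap.finsetSum_comp,
      Finset.sum_filter]
    refine Finset.sum_congr rfl fun k _ => ?_
    rw [component, component, map_comp_map]
    split_ifs with hu
    · rw [map_comp_map]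
      congr 1
      funext i
      by_cases hi : k i = 0
      · have : i ∉ u := by simp [← hu, supp, hi]
        simp [this, hi, h0, h0']
      · have : i ∈ u := by simp [← hu, supp, hi]
        simp [this, ContinuousLinearMap.sub_comp, ContinuousLinearMap.comp_sub, hk _ hi,
          hk' _ hi, ContinuousLinearMap.one_def]
    · obtain ⟨i, hi⟩ : ∃ i, ¬(i ∈ supp k ↔ i ∈ u) := by
        by_contra! h
        exact hu (Finset.ext h)
      refine map_eq_zero (i := i) ?_
      by_cases hi0 : k i = 0
      · have : i ∈ u := by simpa [supp, hi0] using hi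
        simp [this, ContinuousLinearMap.sub_comp, hi0, h0, ContinuousLinearMap.one_def]
      · have : i ∉ u := by simpa [supp, hi0] using hi
        simp [this, hk _ hi0]
  rw [← le_div_iff₀ (by positivity)]
  refine ContinuousLinearMap.opNorm_le_bound _ (by positivity) fun f => ?_
  refine le_of_sq_le_sq ?_ (by positivity)
  -- Pythagoras in both the target and the source reduces the bound to one support `u` at a time.
  rw [← sum_norm_sq_component hP', mul_pow, ← sum_norm_sq_component hP f, Finset.mul_sum]
  refine Finset.sum_le_sum fun u _ => ?_
  rw [hcomp, ← mul_pow]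
  gcongr
  refine ((R u).le_opNorm _).trans ?_
  gcongr
  rw [le_div_iff₀ (by positivity)]
  exact hR u

end HilbertTensorPower

/-! ## Spectral facts -/

section Spectral

variable {F G : Type*} [NormedAddCommGroup F] [InnerProductSpace ℝ F] [CompleteSpace F]
  [NormedAddCommGroup G] [InnerProductSpace ℝ G] [CompleteSpace G]

open ContinuousLinearMap in
-- The norm of the self-adjoint `T* T` is its spectral radius, and nonzero spectral values of a
-- compact operator are eigenvalues.
theorem IsCompactOperator.exists_singularVector {T : F →L[ℝ] G} (hT : IsCompactOperator T)
    (h0 : T ≠ 0) : ∃ v : F, ‖v‖ = 1 ∧ adjoint T (T v) = ‖T‖ ^ 2 • v := by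
  set W : F →L[ℝ] F := adjoint T ∘L T with hW
  have hWn : ‖W‖ = ‖T‖ ^ 2 := by rw [hW, norm_adjoint_comp_self, sq]
  have hWc : IsCompactOperator W := hT.clm_comp (adjoint T)
  have hWs : IsSelfAdjoint W := (isPositive_adjoint_comp_self T).isSelfAdjoint
  have hpos : 0 < ‖T‖ := norm_pos_iff.2 h0
  have hr := spectralRadius_eq_nnnorm W hWs
  -- Over `ℝ` a spectrum may be empty; here that would force spectral radius, hence `‖W‖`, to be
  -- zero.
  have hne : (spectrum ℝ W).Nonempty := by
    by_contra h
    rw [Set.not_nonempty_iff_eq_empty] at h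
    simp only [spectralRadius, h, Set.mem_empty_iff_false, not_false_eq_true, iSup_neg,
      iSup_bot] at hr
    have h1 : ‖W‖₊ = 0 := by
      rw [bot_eq_zero] at hr
      exact_mod_cast hr.symm
    exact (pow_pos hpos 2).ne' (hWn ▸ congrArg NNReal.toReal h1)
  obtain ⟨k, hk, hkr⟩ := spectrum.exists_nnnorm_eq_spectralRadius_of_nonempty hne
  have hkn : |k| = ‖T‖ ^ 2 := by
    rw [hr] at hkr
    rw [← hWn, ← Real.norm_eq_abs]
    exact congrArg NNReal.toReal (ENNReal.coe_injective hkr)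
  have hk0 : k ≠ 0 := by
    rintro rfl
    rw [abs_zero] at hkn
    exact (pow_pos hpos 2).ne hkn
  obtain ⟨w, hw⟩ := ((hWc.hasEigenvalue_iff_mem_spectrum hk0).2 hk).exists_hasEigenvector
  have hw0 : ‖w‖ ≠ 0 := norm_ne_zero_iff.2 hw.2
  have hwe : adjoint T (T w) = k • w := hw.apply_eq_smul
  -- So far only `|k|` is known; `⟨W w, w⟩ = ‖T w‖ ^ 2` fixes the sign.
  have hkpos : 0 ≤ k := by
    have h1 : inner ℝ (adjoint T (T w)) w = ‖T w‖ ^ 2 := by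
      rw [adjoint_inner_left, real_inner_self_eq_norm_sq]
    rw [hwe, inner_smul_left, real_inner_self_eq_norm_sq] at h1
    have h2 : 0 < ‖w‖ ^ 2 := by positivity
    have h3 : 0 ≤ k * ‖w‖ ^ 2 := by
      rw [show k * ‖w‖ ^ 2 = ‖T w‖ ^ 2 from h1]; positivity
    exact nonneg_of_mul_nonneg_left h3 h2
  rw [abs_of_nonneg hkpos] at hkn
  refine ⟨‖w‖⁻¹ • w, by rw [norm_smul, norm_inv, norm_norm, inv_mul_cancel₀ hw0], ?_⟩
  rw [map_smul, map_smul, hwe, hkn, smul_comm]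

theorem le_opNorm_of_eigenvector {W : F →L[ℝ] F} {v : F} {c : ℝ} (hv : ‖v‖ = 1)
    (h : W v = c • v) : c ≤ ‖W‖ := by
  have := W.le_opNorm v
  rw [h, norm_smul, hv, mul_one, mul_one] at this
  exact (le_abs_self c).trans this

/-- The set in the supremum is bounded by `‖W‖`. For `j = 0` it would be all of `ℝ`, hence `hj`. -/
theorem le_orderedEigenvalue {W : F →L[ℝ] F} {j : ℕ} (hj : 0 < j) {μ : ℝ} (v : Fin j → F)
    (c : Fin j → ℝ) (hv : Orthonormal ℝ v) (hc : ∀ i, W (v i) = c i • v i) (hμ : ∀ i, μ ≤ c i) :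
    μ ≤ orderedEigenvalue W j := by
  refine le_csSup ⟨‖W‖, ?_⟩ ⟨v, c, hv, hc, hμ⟩
  rintro ν ⟨v, c, hv, hc, hν⟩
  exact (hν ⟨0, hj⟩).trans (le_opNorm_of_eigenvector (hv.1 _) (hc _))

/-- The orthogonal projection onto the line spanned by a unit vector. -/
def lineProj (η : F) : F →L[ℝ] F := (innerSL ℝ η).smulRight η

theorem lineProj_apply (η f : F) : lineProj η f = (inner ℝ η f : ℝ) • η := rfl

theorem lineProj_self {η : F} (hη : ‖η‖ = 1) : lineProj η η = η := by
  rw [lineProj_apply, real_inner_self_eq_norm_sq, hη]; simp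

theorem inner_sub_lineProj {η : F} (hη : ‖η‖ = 1) (f : F) : inner ℝ η (f - lineProj η f) = 0 := by
  rw [lineProj_apply, inner_sub_right, inner_smul_right, real_inner_self_eq_norm_sq, hη]; simp

theorem inner_lineProj_sub {η : F} (hη : ‖η‖ = 1) (f g : F) :
    inner ℝ (lineProj η f) (g - lineProj η g) = 0 := by
  rw [lineProj_apply, inner_smul_left, inner_sub_lineProj hη, mul_zero]

theorem lineProj_comp_self {η : F} (hη : ‖η‖ = 1) : lineProj η ∘L lineProj η = lineProj η := by
  ext f
  rw [ContinuousLinearMap.comp_apply, lineProj_apply η f, map_smul, lineProj_self hη]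

theorem norm_one_sub_lineProj_le {η : F} (hη : ‖η‖ = 1) : ‖1 - lineProj η‖ ≤ 1 := by
  refine ContinuousLinearMap.opNorm_le_bound _ zero_le_one fun f => ?_
  refine le_of_sq_le_sq ?_ (by positivity)
  have h := norm_add_sq_eq_norm_sq_add_norm_sq_of_inner_eq_zero _ _ (inner_lineProj_sub hη f f)
  rw [add_sub_cancel] at h
  simp only [sub_apply, one_apply_eq_self, one_mul]
  nlinarith [mul_self_nonneg ‖lineProj η f‖]

open ContinuousLinearMap in
/-- A gap between the first two eigenvalues of `S* S` makes `S` strictly smaller on the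
orthogonal complement of the first eigenvector. -/
theorem spectral_gap {S : F →L[ℝ] G} (hS : S ≠ 0) (hc : IsCompactOperator S)
    (hgap : orderedEigenvalue (adjoint S ∘L S) 2 < orderedEigenvalue (adjoint S ∘L S) 1)
    {η : F} (hη : (adjoint S ∘L S) η = orderedEigenvalue (adjoint S ∘L S) 1 • η)
    (hn : ‖η‖ = 1) :
    adjoint S (S η) = ‖S‖ ^ 2 • η ∧ ‖S ∘L (1 - lineProj η)‖ < ‖S‖ := by
  set W := adjoint S ∘L S with hW
  have hWn : ‖W‖ = ‖S‖ ^ 2 := by rw [hW, norm_adjoint_comp_self, sq]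
  have h1 : orderedEigenvalue W 1 = ‖S‖ ^ 2 := by
    refine le_antisymm (hWn ▸ le_opNorm_of_eigenvector hn hη) ?_
    obtain ⟨v, hv, hve⟩ := hc.exists_singularVector hS
    refine le_orderedEigenvalue one_pos (fun _ => v) (fun _ => ‖S‖ ^ 2) ?_ (fun _ => hve)
      fun _ => le_rfl
    exact ⟨fun _ => hv, fun i j hij => absurd (Subsingleton.elim i j) hij⟩
  rw [h1] at hη hgap
  refine ⟨hη, ?_⟩
  have hη' : adjoint S (S η) = ‖S‖ ^ 2 • η := hη
  set S' := S ∘L (1 - lineProj η) with hS'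
  by_cases h0 : S' = 0
  · rw [h0, norm_zero]; exact norm_pos_iff.2 hS
  have hle : ‖S'‖ ≤ ‖S‖ := (opNorm_comp_le _ _).trans <|
    mul_le_of_le_one_right (norm_nonneg _) (norm_one_sub_lineProj_le hn)
  have hc' : IsCompactOperator S' := hc.comp_clm (1 - lineProj η)
  obtain ⟨v, hv, hve⟩ := hc'.exists_singularVector h0
  have hpos : 0 < ‖S'‖ := norm_pos_iff.2 h0
  have hSη : S' η = 0 := by simp [hS', lineProj_self hn]
  -- A top singular vector `v` of `S'` is orthogonal to the kernel vector `η`. It is therefore an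
  -- eigenvector of `W` too, and the orthonormal pair `η, v` gives `‖S'‖ ^ 2 ≤ λ₂`.
  have hηv : inner ℝ η v = 0 := by
    have : inner ℝ η (‖S'‖ ^ 2 • v) = 0 := by
      rw [← hve, adjoint_inner_right, hSη, inner_zero_left]
    rw [inner_smul_right] at this
    exact (mul_eq_zero.1 this).resolve_left (by positivity)
  have hSv : S' v = S v := by simp [hS', lineProj_apply, hηv]
  have hWv : W v = ‖S'‖ ^ 2 • v := by
    rw [← hve]
    refine ext_inner_left ℝ fun f => ?_
    rw [adjoint_inner_right, hSv, hW, comp_apply, adjoint_inner_right]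
    have : inner ℝ (S η) (S v) = 0 := by
      rw [← adjoint_inner_left, hη', inner_smul_left, hηv, mul_zero]
    simp [hS', lineProj_apply, inner_sub_left, inner_smul_left, this]
  have h2 : ‖S'‖ ^ 2 ≤ orderedEigenvalue W 2 := by
    refine le_orderedEigenvalue two_pos ![η, v] ![‖S‖ ^ 2, ‖S'‖ ^ 2] ?_ ?_ ?_
    · constructor
      · simp [Fin.forall_fin_two, hn, hv]
      · intro i j hij
        have hvη : inner ℝ v η = 0 := by rw [real_inner_comm]; exact hηv
        fin_cases i <;> fin_cases j <;> simp_all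
    · simp only [Fin.forall_fin_two, Matrix.cons_val_zero, Matrix.cons_val_one]
      exact ⟨hη, hWv⟩
    · simp only [Fin.forall_fin_two, Matrix.cons_val_zero, Matrix.cons_val_one, le_refl, and_true]
      gcongr
  exact lt_of_pow_lt_pow_left₀ 2 (norm_nonneg _) (h2.trans_lt hgap)

end Spectral

/-! ## Algorithms using function values -/

section Sampling

variable {H G X : Type*} [NormedAddCommGroup H] [InnerProductSpace ℝ H] [RKHS ℝ H X ℝ]
  [NormedAddCommGroup G] [InnerProductSpace ℝ G]

/-- `A` is an algorithm for `S` that uses at most `N` function values. -/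
def UsesAtMost (S : H →L[ℝ] G) (N : ℕ) (A : H →L[ℝ] G) : Prop :=
  ∃ n ≤ N, A ∈ stdAlgorithms S n

theorem usesAtMost_of_fintype {S : H →L[ℝ] G} {κ : Type*} [Fintype κ] (t : κ → X) (g : κ → G)
    (hg : ∀ j, g j ∈ Set.range S) :
    UsesAtMost S (Fintype.card κ) (∑ j, (evalCLM H (t j)).smulRight (g j)) := by
  refine ⟨_, le_rfl, t ∘ (Fintype.equivFin κ).symm, g ∘ (Fintype.equivFin κ).symm,
    fun j => hg _, ?_⟩
  exact ((Fintype.equivFin κ).symm.sum_comp fun j => (evalCLM H (t j)).smulRight (g j)).symm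

namespace UsesAtMost

variable {S A B : H →L[ℝ] G} {N M : ℕ}

theorem mono (h : UsesAtMost S N A) (hNM : N ≤ M) : UsesAtMost S M A :=
  let ⟨n, hn, hA⟩ := h
  ⟨n, hn.trans hNM, hA⟩

protected theorem zero : UsesAtMost S 0 0 :=
  ⟨0, le_rfl, Fin.elim0, Fin.elim0, fun j => j.elim0, by simp [sampling]⟩

theorem add (hA : UsesAtMost S N A) (hB : UsesAtMost S M B) : UsesAtMost S (N + M) (A + B) := by
  obtain ⟨n, hn, t, g, hg, rfl⟩ := hA
  obtain ⟨m, hm, t', g', hg', rfl⟩ := hB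
  have := usesAtMost_of_fintype (S := S) (Sum.elim t t') (Sum.elim g g') (by
    rintro (j | j)
    · exact hg j
    · exact hg' j)
  simp only [Fintype.card_sum, Fintype.card_fin, Fintype.sum_sum_type, Sum.elim_inl,
    Sum.elim_inr] at this
  exact this.mono (add_le_add hn hm)

theorem sum {κ : Type*} (s : Finset κ) {N : κ → ℕ} {A : κ → H →L[ℝ] G}
    (h : ∀ k ∈ s, UsesAtMost S (N k) (A k)) :
    UsesAtMost S (∑ k ∈ s, N k) (∑ k ∈ s, A k) := by
  classical
  induction s using Finset.induction_on with
  | empty => simpa using UsesAtMost.zero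
  | insert a s ha ih =>
    rw [Finset.sum_insert ha, Finset.sum_insert ha]
    exact (h a (by simp)).add (ih fun k hk => h k (by simp [hk]))

/-- Algorithms must have coefficients in the range of `S`, so `L` has to preserve that range. -/
theorem clm_comp (L : G →L[ℝ] G) (hL : ∀ f, L (S f) ∈ Set.range S) (hA : UsesAtMost S N A) :
    UsesAtMost S N (L ∘L A) := by
  obtain ⟨n, hn, t, g, hg, rfl⟩ := hA
  refine ⟨n, hn, t, fun j => L (g j), fun j => ?_, ?_⟩
  · obtain ⟨f, hf⟩ := hg j
    change L (g j) ∈ _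
    rw [← hf]
    exact hL f
  · ext f
    simp [sampling_apply]

theorem neg (hA : UsesAtMost S N A) : UsesAtMost S N (-A) := by
  have := hA.clm_comp (-1) fun f => ⟨-f, by simp⟩
  convert this using 1
  ext f
  simp

theorem sub (hA : UsesAtMost S N A) (hB : UsesAtMost S M B) : UsesAtMost S (N + M) (A - B) :=
  sub_eq_add_neg A B ▸ hA.add hB.neg

theorem smulRight (t : X) {g : G} (hg : g ∈ Set.range S) :
    UsesAtMost S 1 ((evalCLM H t).smulRight g) :=
  ⟨1, le_rfl, fun _ => t, fun _ => g, fun _ => hg, by simp [sampling]⟩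

theorem apply_mem_range (hA : UsesAtMost S N A) (f : H) : A f ∈ Set.range S := by
  obtain ⟨n, -, t, g, hg, rfl⟩ := hA
  choose φ hφ using hg
  exact ⟨∑ j, f (t j) • φ j, by simp [sampling_apply, hφ]⟩

theorem infoComplexity_le {ε : ℝ} (hA : UsesAtMost S N A) (h : ‖S - A‖ ≤ ε * ‖S‖) :
    infoComplexity ε S ≤ N := by
  obtain ⟨n, hn, hA⟩ := hA
  refine (iInf₂_le n ⟨A, hA, ?_⟩).trans (by exact_mod_cast hn)
  simpa [worstCaseError, initialError] using h

/-- Tensor products of algorithms are algorithms for the tensor product problem. -/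
theorem tensor [CompleteSpace H] {ι : Type*} [Fintype ι] {N : ι → ℕ} {A : ι → H →L[ℝ] G}
    (hA : ∀ i, UsesAtMost S (N i) (A i)) :
    UsesAtMost (HilbertTensorPower.map fun _ : ι => S) (∏ i, N i) (HilbertTensorPower.map A) := by
  classical
  choose n hn t g hg hA using hA
  choose φ hφ using hg
  have h := usesAtMost_of_fintype (S := HilbertTensorPower.map fun _ : ι => S)
    (κ := ∀ i, Fin (n i)) (fun j i => t i (j i))
    (fun j => HilbertTensorPower.tprod fun i => g i (j i)) fun j =>
      ⟨HilbertTensorPower.tprod fun i => φ i (j i), by simp [HilbertTensorPower.map_tprod, hφ]⟩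
  have e : HilbertTensorPower.map A = ∑ j : ∀ i, Fin (n i),
      (evalCLM (HilbertTensorPower ι H) fun i => t i (j i)).smulRight
        (HilbertTensorPower.tprod fun i => g i (j i)) := by
    refine HilbertTensorPower.clm_ext fun x => ?_
    rw [HilbertTensorPower.map_tprod, sum_apply]
    simp only [hA, sampling_apply, ContinuousLinearMap.smulRight_apply, evalCLM_apply,
      HilbertTensorPower.tprod_apply]
    simp only [← HilbertTensorPower.tprodMultilinear_apply, MultilinearMap.map_sum,
      MultilinearMap.map_smul_univ]
  rw [e]
  refine h.mono ?_
  rw [Fintype.card_pi]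
  exact Finset.prod_le_prod' fun i _ => by simpa using hn i

end UsesAtMost

/-- Polynomial decay of the minimal errors gives algorithms with geometrically decreasing errors
whose numbers of function values grow geometrically. -/
theorem exists_geometric_approximation [Nonempty X] {S : H →L[ℝ] G}
    (h : 0 < polyDecay (minimalError S)) {δ : ℝ} (hδ : 0 < δ) :
    ∃ c : ℕ, 1 ≤ c ∧ ∀ k ≠ 0, ∃ A, UsesAtMost S (c ^ k) A ∧ ‖S - A‖ ≤ δ / 4 ^ k := by
  obtain ⟨r, hr⟩ := lt_iSup_iff.1 h
  obtain ⟨hlim, hr0⟩ := lt_iSup_iff.1 hr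
  have hr0 : 0 < (r : ℝ) := by exact_mod_cast hr0
  have h1 : ∀ᶠ n : ℕ in atTop, (n : ℝ) ^ (r : ℝ) * minimalError S n < 1 :=
    hlim.eventually_lt_const one_pos
  obtain ⟨n₁, hn₁⟩ := eventually_atTop.1 h1
  have h2 : Tendsto (fun n : ℕ => (n : ℝ) ^ (r : ℝ)) atTop atTop :=
    (tendsto_rpow_atTop hr0).comp tendsto_natCast_atTop_atTop
  -- With `c ^ r ≥ 4 * max 1 δ⁻¹`, taking `k`-th powers gives `(c ^ k) ^ r ≥ 4 ^ k * δ⁻¹` for `k ≥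
  -- 1`. The maximum with `1` lets its power dominate `δ⁻¹`.
  obtain ⟨c, hc, hcn, hc1⟩ := ((h2.eventually_ge_atTop (4 * max 1 δ⁻¹)).and
    ((eventually_ge_atTop n₁).and (eventually_ge_atTop 1))).exists
  refine ⟨c, hc1, fun k hk => ?_⟩
  have hck : n₁ ≤ c ^ k := hcn.trans (Nat.le_self_pow hk c)
  have hpos : (0 : ℝ) < ((c ^ k : ℕ) : ℝ) ^ (r : ℝ) :=
    Real.rpow_pos_of_pos (by exact_mod_cast pow_pos hc1 k) _
  have h3 : minimalError S (c ^ k) < 1 / ((c ^ k : ℕ) : ℝ) ^ (r : ℝ) := by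
    rw [lt_div_iff₀ hpos, mul_comm]
    exact hn₁ _ hck
  have hne : (worstCaseError S '' stdAlgorithms S (c ^ k)).Nonempty :=
    Set.Nonempty.image _
      ⟨_, fun _ => Classical.arbitrary X, fun _ => 0, fun _ => ⟨0, map_zero S⟩, rfl⟩
  -- The infimum need not be attained; the strict bound `h3` supplies an actual algorithm.
  obtain ⟨_, ⟨A, hA, rfl⟩, hlt⟩ := exists_lt_of_csInf_lt hne h3
  refine ⟨A, ⟨_, le_rfl, hA⟩, hlt.le.trans ?_⟩
  have h4 : 4 ^ k * δ⁻¹ ≤ ((c ^ k : ℕ) : ℝ) ^ (r : ℝ) := by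
    rw [Nat.cast_pow, ← Real.rpow_pow_comm (Nat.cast_nonneg c)]
    calc (4 : ℝ) ^ k * δ⁻¹ ≤ 4 ^ k * max 1 δ⁻¹ ^ k := by
          gcongr
          exact (le_max_right 1 δ⁻¹).trans (le_self_pow₀ (le_max_left _ _) hk)
      _ = (4 * max 1 δ⁻¹) ^ k := (mul_pow _ _ _).symm
      _ ≤ _ := by gcongr
  rw [div_le_div_iff₀ hpos (by positivity), one_mul]
  calc (4 : ℝ) ^ k = δ * (4 ^ k * δ⁻¹) := by field_simp
    _ ≤ _ := by gcongr

end Sampling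

/-! ## The univariate building blocks -/

section Blocks

variable {F G X : Type*} [NormedAddCommGroup F] [InnerProductSpace ℝ F] [CompleteSpace F]
  [RKHS ℝ F X ℝ] [NormedAddCommGroup G] [InnerProductSpace ℝ G] [CompleteSpace G]

/-- The univariate operator is a sum of differences of algorithms, up to a remainder of index
`Q + 1`; the blocks respect the splitting along `η` and their weighted norms sum up to at most
`‖S‖`. -/
theorem exists_blocks {S : F →L[ℝ] G} (hS : S ≠ 0) {η : F} (hη : ‖η‖ = 1)
    (hηS : ContinuousLinearMap.adjoint S (S η) = ‖S‖ ^ 2 • η)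
    (hgap : ‖S ∘L (1 - lineProj η)‖ < ‖S‖) {t : X} {a : ℝ} (ht : ∀ f : F, inner ℝ η f = a * f t)
    (hdecay : 0 < polyDecay (minimalError S)) :
    ∃ (ρ : ℝ) (c : ℕ) (ζ : G), 1 < ρ ∧ 1 ≤ c ∧ ‖ζ‖ = 1 ∧ ∀ Q : ℕ, ∃ Δ : ℕ → F →L[ℝ] G,
      S = ∑ k ∈ Finset.range (Q + 2), Δ k ∧
      lineProj ζ ∘L Δ 0 = Δ 0 ∧ Δ 0 ∘L lineProj η = Δ 0 ∧
      (∀ k ≠ 0, lineProj ζ ∘L Δ k = 0) ∧ (∀ k ≠ 0, Δ k ∘L lineProj η = 0) ∧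
      ‖Δ 0‖ ≤ ‖S‖ ∧ ∑ k ∈ Finset.Ico 1 (Q + 2), ρ ^ k * ‖Δ k‖ ≤ ‖S‖ ∧
      ∀ k ≤ Q, UsesAtMost S (c ^ k) (Δ k) := by
  have : Nonempty X := ⟨t⟩
  set s := ‖S‖ with hs
  have hs0 : 0 < s := norm_pos_iff.2 hS
  set P := lineProj η with hP
  set S' := S ∘L (1 - P) with hS'
  set σ := ‖S'‖ with hσ
  have hσ0 : 0 ≤ σ := norm_nonneg _
  -- Chosen together with `ρ = 2 * s / (s + σ)` so that `ρ * σ + 4 * δ * ρ = s`.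
  set δ := (s - σ) / 8 with hδ
  have hδ0 : 0 < δ := by rw [hδ]; linarith
  obtain ⟨c, hc, happ⟩ := exists_geometric_approximation hdecay hδ0
  choose! A hA hAe using happ
  have hSη : ∀ f, inner ℝ (S η) (S f) = s ^ 2 * inner ℝ η f := fun f => by
    rw [← ContinuousLinearMap.adjoint_inner_left, hηS, inner_smul_left]; simp
  have hSηn : ‖S η‖ = s := by
    refine (sq_eq_sq₀ (norm_nonneg _) hs0.le).1 ?_
    rw [← real_inner_self_eq_norm_sq, hSη, real_inner_self_eq_norm_sq, hη]; simp
  set ζ := s⁻¹ • S η with hζ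
  have hζ1 : ‖ζ‖ = 1 := by
    rw [hζ, norm_smul, hSηn, norm_inv, Real.norm_of_nonneg hs0.le, inv_mul_cancel₀ hs0.ne']
  set P' := lineProj ζ with hP'
  have hPP : P ∘L P = P := lineProj_comp_self hη
  have hPP' : P' ∘L P' = P' := lineProj_comp_self hζ1
  -- As `η` is an eigenvector of `S* S`, the operator `S` respects the splittings along `η` and `ζ`.
  have hP'S : P' ∘L S = S ∘L P := by
    ext f
    simp only [ContinuousLinearMap.comp_apply, hP', hP, lineProj_apply, hζ, inner_smul_left,
      hSη, map_smul, smul_smul, conj_trivial]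
    congr 1
    field_simp
  have hP'S' : P' ∘L S' = 0 := by
    rw [hS', ← ContinuousLinearMap.comp_assoc, hP'S, ContinuousLinearMap.comp_assoc,
      ContinuousLinearMap.comp_sub, hPP]
    ext f; simp
  have hS'P : S' ∘L P = 0 := by
    rw [hS', ContinuousLinearMap.comp_assoc, ContinuousLinearMap.sub_comp, hPP]
    ext f; simp
  -- Compressing `A k` to the two complements preserves the error bound, since `S'` equals its own
  -- compression.
  let U : ℕ → F →L[ℝ] G := fun k => if k = 0 then 0 else (1 - P') ∘L A k ∘L (1 - P)
  have hP'U : ∀ k, P' ∘L U k = 0 := fun k => by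
    by_cases hk : k = 0
    · simp [U, hk]
    · simp only [U, hk, if_false]
      rw [← ContinuousLinearMap.comp_assoc, ContinuousLinearMap.comp_sub, hPP']
      ext f; simp
  have hUP : ∀ k, U k ∘L P = 0 := fun k => by
    by_cases hk : k = 0
    · simp [U, hk]
    · simp only [U, hk, if_false]
      have h0 : (1 - P) ∘L P = 0 := by
        rw [ContinuousLinearMap.sub_comp, hPP]
        ext f; simp
      rw [ContinuousLinearMap.comp_assoc, ContinuousLinearMap.comp_assoc, h0,
        ContinuousLinearMap.comp_zero, ContinuousLinearMap.comp_zero]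
  have hUe : ∀ k ≠ 0, ‖S' - U k‖ ≤ δ / 4 ^ k := fun k hk => by
    have e : S' - U k = (1 - P') ∘L (S - A k) ∘L (1 - P) := by
      have : (1 - P') ∘L S' = S' := by
        rw [ContinuousLinearMap.sub_comp, hP'S']
        ext f; simp
      calc S' - U k = (1 - P') ∘L S' - U k := by rw [this]
        _ = _ := by
          simp only [U, hk, if_false, hS', ContinuousLinearMap.sub_comp,
            ContinuousLinearMap.comp_sub]
          abel
    rw [e]
    calc _ ≤ ‖1 - P'‖ * (‖S - A k‖ * ‖1 - P‖) :=
          (ContinuousLinearMap.opNorm_comp_le _ _).trans <| by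
            gcongr
            exact ContinuousLinearMap.opNorm_comp_le _ _
      _ ≤ 1 * (‖S - A k‖ * 1) := by
          gcongr
          · exact norm_one_sub_lineProj_le hζ1
          · exact norm_one_sub_lineProj_le hη
      _ ≤ _ := by rw [one_mul, mul_one]; exact hAe k hk
  have hPrange : ∀ f, (1 - P') (S f) ∈ Set.range S := fun f => ⟨f - P f, by
    have := congrArg (fun T => T f) hP'S
    simp only [ContinuousLinearMap.comp_apply] at this
    simp [this]⟩
  -- The kernel hypothesis enters here: anything composed with `P` costs one sample at `t`. Hence `U
  -- k` needs at most `c ^ k + 1 ≤ 2 * c ^ k` values.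
  have heval : ∀ B : F →L[ℝ] G, B ∘L P = (evalCLM F t).smulRight (a • B η) := fun B => by
    ext f
    simp [hP, lineProj_apply, ht, evalCLM_apply, smul_smul, mul_comm]
  have hU : ∀ k, UsesAtMost S (2 * c ^ k) (U k) := fun k => by
    by_cases hk : k = 0
    · simp only [U, hk, if_true]
      exact UsesAtMost.zero.mono (Nat.zero_le _)
    · have h1 := (hA k hk).clm_comp (1 - P') hPrange
      obtain ⟨φ, hφ⟩ := h1.apply_mem_range η
      have h2 : UsesAtMost S 1 (((1 - P') ∘L A k) ∘L P) := by
        rw [heval]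
        exact .smulRight t ⟨a • φ, by rw [map_smul, hφ]⟩
      have h3 := h1.sub h2
      have e : U k = (1 - P') ∘L A k - ((1 - P') ∘L A k) ∘L P := by
        ext f
        simp [U, hk]
      rw [e]
      refine h3.mono ?_
      have := Nat.one_le_pow k c hc
      omega
  have hU0 : U 0 = 0 := by simp [U]
  have hρ1 : 1 < 2 * s / (s + σ) := by
    rw [lt_div_iff₀ (by positivity)]; linarith
  -- A difference of consecutive `U`'s costs `2 * c ^ (k + 1) + 2 * c ^ k ≤ (4 * c) ^ (k + 1)`.
  refine ⟨2 * s / (s + σ), 4 * c, ζ, hρ1, by omega, hζ1, fun Q => ?_⟩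
  set ρ := 2 * s / (s + σ) with hρ
  clear_value ρ
  -- Beyond level `Q` the exact `S'` is used, so the telescoping sum up to `Q + 1` equals `S`
  -- exactly. The last block need not be an algorithm: no retained multi-index contains it.
  let V : ℕ → F →L[ℝ] G := fun k => if k ≤ Q then U k else S'
  have hV0 : V 0 = 0 := by simp [V, hU0]
  have hVe : ∀ k ≠ 0, ‖S' - V k‖ ≤ δ / 4 ^ k := fun k hk => by
    by_cases h : k ≤ Q
    · simpa [V, h] using hUe k hk
    · simp only [V, h, if_false, sub_self, norm_zero]; positivity
  have hP'V : ∀ k, P' ∘L V k = 0 := fun k => by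
    by_cases h : k ≤ Q
    · simpa [V, h] using hP'U k
    · simpa [V, h] using hP'S'
  have hVP : ∀ k, V k ∘L P = 0 := fun k => by
    by_cases h : k ≤ Q
    · simpa [V, h] using hUP k
    · simpa [V, h] using hS'P
  let Δ : ℕ → F →L[ℝ] G := fun k => if k = 0 then S ∘L P else V k - V (k - 1)
  have hΔ0 : Δ 0 = S ∘L P := by simp [Δ]
  have hΔ : ∀ k, Δ (k + 1) = V (k + 1) - V k := fun k => by simp [Δ]
  have hΔn : ∀ k, ‖Δ (k + 1)‖ ≤ (if k = 0 then σ else 0) + 2 * δ / 4 ^ k := fun k => by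
    have h1 := hVe (k + 1) k.succ_ne_zero
    have h14 : δ / 4 ^ (k + 1) ≤ δ / 4 ^ k := by
      gcongr
      · norm_num
      · omega
    rw [hΔ]
    by_cases hk : k = 0
    · subst hk
      have e : V (0 + 1) - V 0 = S' - (S' - V (0 + 1)) := by rw [hV0]; abel
      rw [e]
      refine (norm_sub_le _ _).trans ?_
      simp only [if_true]
      norm_num at h1 ⊢
      linarith
    · have e : V (k + 1) - V k = (S' - V k) - (S' - V (k + 1)) := by abel
      rw [e, if_neg hk, zero_add]
      refine (norm_sub_le _ _).trans ?_
      have h2 := hVe k hk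
      rw [mul_div_assoc]
      linarith
  refine ⟨Δ, ?_, ?_, ?_, ?_, ?_, ?_, ?_, ?_⟩
  · rw [Finset.sum_range_succ', hΔ0]
    simp only [hΔ]
    rw [Finset.sum_range_sub, hV0]
    simp only [V, show ¬ Q + 1 ≤ Q by omega, if_false, hS']
    ext f; simp
  · rw [hΔ0, ← ContinuousLinearMap.comp_assoc, hP'S, ContinuousLinearMap.comp_assoc, hPP]
  · rw [hΔ0, ContinuousLinearMap.comp_assoc, hPP]
  · intro k hk
    obtain ⟨k, rfl⟩ := Nat.exists_eq_succ_of_ne_zero hk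
    rw [Nat.succ_eq_add_one, hΔ, ContinuousLinearMap.comp_sub, hP'V, hP'V, sub_zero]
  · intro k hk
    obtain ⟨k, rfl⟩ := Nat.exists_eq_succ_of_ne_zero hk
    rw [Nat.succ_eq_add_one, hΔ, ContinuousLinearMap.sub_comp, hVP, hVP, sub_zero]
  · rw [hΔ0]
    refine ContinuousLinearMap.opNorm_le_bound _ hs0.le fun f => ?_
    rw [ContinuousLinearMap.comp_apply, hP, lineProj_apply, map_smul, norm_smul, hSηn, mul_comm]
    gcongr
    simpa [hη] using norm_inner_le_norm (𝕜 := ℝ) η f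
  -- This turns `(ρ / 4) ^ k` into a geometric series of ratio `1 / 2`, with sum at most `2`.
  · have hρ2 : ρ ≤ 2 := by
      rw [hρ, div_le_iff₀ (by positivity)]; linarith
    have hρ0 : 0 < ρ := one_pos.trans hρ1
    rw [Finset.sum_Ico_eq_sum_range, show Q + 2 - 1 = Q + 1 by omega]
    calc ∑ k ∈ Finset.range (Q + 1), ρ ^ (1 + k) * ‖Δ (1 + k)‖
        ≤ ∑ k ∈ Finset.range (Q + 1), ((if k = 0 then ρ * σ else 0) +
            2 * δ * ρ * (1 / 2) ^ k) := by
          refine Finset.sum_le_sum fun k _ => ?_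
          rw [add_comm 1 k]
          calc ρ ^ (k + 1) * ‖Δ (k + 1)‖
              ≤ ρ ^ (k + 1) * ((if k = 0 then σ else 0) + 2 * δ / 4 ^ k) := by
                gcongr
                exact hΔn k
            _ = (if k = 0 then ρ * σ else 0) + 2 * δ * ρ * (ρ / 4) ^ k := by
                rw [mul_add, div_pow]
                congr 1
                · split_ifs with h
                  · simp [h]
                  · simp
                · rw [pow_succ]; ring
            _ ≤ _ := by
                have : ρ / 4 ≤ 1 / 2 := by linarith
                have := pow_le_pow_left₀ (by positivity) this k
                gcongr
      _ = ρ * σ + 2 * δ * ρ * ∑ k ∈ Finset.range (Q + 1), (1 / 2 : ℝ) ^ k := by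
          rw [Finset.sum_add_distrib, Finset.mul_sum]
          congr 1
          simp
      _ ≤ ρ * σ + 2 * δ * ρ * 2 := by
          gcongr
          exact sum_geometric_two_le _
      _ = s := by
          rw [hρ, hδ]
          have : s + σ ≠ 0 := by positivity
          field_simp
          ring
  · intro k hk
    by_cases h0 : k = 0
    · subst h0
      rw [hΔ0, heval]
      exact UsesAtMost.smulRight t ⟨a • η, by rw [map_smul]⟩
    · obtain ⟨k, rfl⟩ := Nat.exists_eq_succ_of_ne_zero h0
      rw [Nat.succ_eq_add_one] at hk ⊢
      rw [hΔ]
      simp only [V, hk, show k ≤ Q by omega, if_true]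
      refine ((hU (k + 1)).sub (hU k)).mono ?_
      have h1 : c ^ k ≤ c ^ (k + 1) := Nat.pow_le_pow_right hc (by omega)
      have h2 : 4 * c ^ (k + 1) ≤ (4 * c) ^ (k + 1) := by
        rw [mul_pow]
        exact Nat.mul_le_mul_right _ (Nat.le_self_pow (by omega) 4)
      omega

end Blocks

/-! ## Cost and error of the Smolyak algorithm -/

/-- An exponential weight replaces counting: with `x = 1 / (2 * d)`, `c ^ |k| = (2 * c * d) ^ |k| *
x ^ |k|`, where `|k| ≤ Q`. Dropping the constraint makes the sum of `x ^ |k|` a product, at most `(1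
+ 1 / d) ^ d ≤ e`. -/
theorem sum_pow_le_of_sum_le {c d : ℕ} (hc : 1 ≤ c) (hd : 1 ≤ d) (N Q : ℕ) :
    ∑ k ∈ Fintype.piFinset (fun _ : Fin d => Finset.range N) with ¬ Q < ∑ i, k i,
      (c : ℝ) ^ (∑ i, k i) ≤ Real.exp 1 * (2 * c * d) ^ Q := by
  have hc' : (1 : ℝ) ≤ c := by exact_mod_cast hc
  have hd' : (1 : ℝ) ≤ d := by exact_mod_cast hd
  have hd0 : (0 : ℝ) < d := by linarith
  set x : ℝ := 1 / (2 * d) with hx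
  have hx0 : 0 < x := by positivity
  have hb : 1 ≤ 2 * (c : ℝ) * d := by nlinarith
  have hgeom : ∑ i ∈ Finset.range N, x ^ i ≤ 1 + 1 / d := by
    set y : ℝ := 1 / d with hy
    have hxy : x = y / 2 := by rw [hx, hy]; field_simp
    have hy0 : 0 < y := by positivity
    have hy1 : y ≤ 1 := by rw [hy, div_le_one hd0]; exact hd'
    have h1 := mul_neg_geom_sum x N
    have h2 : 0 ≤ ∑ i ∈ Finset.range N, x ^ i := by positivity
    calc ∑ i ∈ Finset.range N, x ^ i
        ≤ ((1 + y) * (1 - x)) * ∑ i ∈ Finset.range N, x ^ i :=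
          le_mul_of_one_le_left h2 (by rw [hxy]; nlinarith)
      _ = (1 + y) * (1 - x ^ N) := by rw [mul_assoc, h1]
      _ ≤ 1 + y := mul_le_of_le_one_right (by positivity) (by linarith [pow_pos hx0 N])
  calc ∑ k ∈ Fintype.piFinset (fun _ : Fin d => Finset.range N) with ¬ Q < ∑ i, k i,
        (c : ℝ) ^ (∑ i, k i)
      ≤ ∑ k ∈ Fintype.piFinset (fun _ : Fin d => Finset.range N) with ¬ Q < ∑ i, k i,
          (2 * c * d) ^ Q * ∏ i, x ^ k i := by
        refine Finset.sum_le_sum fun k hk => ?_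
        rw [Finset.mem_filter, not_lt] at hk
        rw [Finset.prod_pow_eq_pow_sum]
        have : (c : ℝ) = 2 * c * d * x := by rw [hx]; field_simp
        calc (c : ℝ) ^ (∑ i, k i) = (2 * c * d) ^ (∑ i, k i) * x ^ (∑ i, k i) := by
              rw [← mul_pow, ← this]
          _ ≤ _ := by
              gcongr
              exact hk.2
    _ ≤ ∑ k ∈ Fintype.piFinset (fun _ : Fin d => Finset.range N),
          (2 * c * d) ^ Q * ∏ i, x ^ k i :=
        Finset.sum_le_sum_of_subset_of_nonneg (Finset.filter_subset _ _) fun _ _ _ => by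
          positivity
    _ = (2 * c * d) ^ Q * (∑ i ∈ Finset.range N, x ^ i) ^ d := by
        rw [← Finset.mul_sum, ← Finset.prod_univ_sum (fun _ : Fin d => Finset.range N)
          fun _ i => x ^ i]
        simp
    _ ≤ (2 * c * d) ^ Q * (1 + 1 / d) ^ d := by gcongr
    _ ≤ (2 * c * d) ^ Q * Real.exp (1 / d) ^ d := by
        gcongr
        rw [add_comm]
        exact Real.add_one_le_exp _
    _ = _ := by
        rw [← Real.exp_nat_mul, mul_one_div_cancel hd0.ne', mul_comm]

section Smolyak

variable {F G X : Type*} [NormedAddCommGroup F] [InnerProductSpace ℝ F] [CompleteSpace F]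
  [RKHS ℝ F X ℝ] [NormedAddCommGroup G] [InnerProductSpace ℝ G] [CompleteSpace G]

/-- The Smolyak algorithm: cost and normalized error, with constants independent of `d`. -/
theorem exists_smolyak {S : F →L[ℝ] G} (hS : S ≠ 0) {η : F} (hη : ‖η‖ = 1)
    (hηS : ContinuousLinearMap.adjoint S (S η) = ‖S‖ ^ 2 • η)
    (hgap : ‖S ∘L (1 - lineProj η)‖ < ‖S‖) {t : X} {a : ℝ} (ht : ∀ f : F, inner ℝ η f = a * f t)
    (hdecay : 0 < polyDecay (minimalError S)) :
    ∃ (ρ : ℝ) (c : ℕ), 1 < ρ ∧ 1 ≤ c ∧ ∀ Q d : ℕ, 1 ≤ d → ∃ (N : ℕ)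
      (A : HilbertTensorPower (Fin d) F →L[ℝ] HilbertTensorPower (Fin d) G),
      UsesAtMost (tensorPowerOp S d) N A ∧ (N : ℝ) ≤ Real.exp 1 * (2 * c * d) ^ Q ∧
      ‖tensorPowerOp S d - A‖ * ρ ^ Q ≤ ‖tensorPowerOp S d‖ := by
  obtain ⟨ρ, c, ζ, hρ, hc, hζ, hΔ⟩ := exists_blocks hS hη hηS hgap ht hdecay
  refine ⟨ρ, c, hρ, hc, fun Q d hd => ?_⟩
  obtain ⟨Δ, hsum, h0, h0', hk, hk', hs, hs', hA⟩ := hΔ Q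
  let B := Fintype.piFinset (fun _ : Fin d => Finset.range (Q + 2))
  have hexp : tensorPowerOp S d = ∑ k ∈ B, HilbertTensorPower.map (fun i => Δ (k i)) := by
    rw [tensorPowerOp]
    conv_lhs => rw [hsum]
    exact (HilbertTensorPower.mapMultilinear (Fin d) F G).map_sum_finset (fun _ k => Δ k)
      fun _ => Finset.range (Q + 2)
  refine ⟨∑ k ∈ B with ¬ Q < ∑ i, k i, ∏ i, c ^ k i,
    ∑ k ∈ B with ¬ Q < ∑ i, k i, HilbertTensorPower.map (fun i => Δ (k i)), ?_, ?_, ?_⟩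
  · refine UsesAtMost.sum _ fun k hk => UsesAtMost.tensor fun i => hA _ ?_
    rw [Finset.mem_filter, not_lt] at hk
    exact (Finset.single_le_sum (f := k) (fun _ _ => Nat.zero_le _) (Finset.mem_univ i)).trans hk.2
  · push_cast
    simp only [Finset.prod_pow_eq_pow_sum]
    exact sum_pow_le_of_sum_le hc hd (Q + 2) Q
  · have e : tensorPowerOp S d - ∑ k ∈ B with ¬ Q < ∑ i, k i,
        HilbertTensorPower.map (fun i => Δ (k i)) =
        ∑ k ∈ B with Q < ∑ i, k i, HilbertTensorPower.map (fun i => Δ (k i)) := by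
      rw [hexp, ← Finset.sum_filter_add_sum_filter_not B (fun k => Q < ∑ i, k i),
        add_sub_cancel_right]
    rw [e]
    refine (HilbertTensorPower.norm_smolyak_tail_le (inner_lineProj_sub hη)
      (inner_lineProj_sub hζ) h0 h0' hk hk' hρ.le hs hs' Q).trans ?_
    have hSη : ‖S η‖ = ‖S‖ := by
      refine (sq_eq_sq₀ (norm_nonneg _) (norm_nonneg _)).1 ?_
      rw [← real_inner_self_eq_norm_sq, ← ContinuousLinearMap.adjoint_inner_left, hηS,
        inner_smul_left, real_inner_self_eq_norm_sq, hη]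
      simp
    -- Testing on `η ⊗ ⋯ ⊗ η` gives `‖S‖ ^ d ≤ ‖S_d‖`, which normalizes the tail bound.
    have h := (tensorPowerOp S d).le_opNorm (HilbertTensorPower.tprod fun _ => η)
    rw [tensorPowerOp, HilbertTensorPower.map_tprod, HilbertTensorPower.norm_tprod,
      HilbertTensorPower.norm_tprod] at h
    simpa [hη, hSη, tensorPowerOp] using h

end Smolyak

end

/-! ### Choice of the level and quasi-polynomial tractability -/

theorem theorem1 {X F₁ G₁ : Type*}
    [NormedAddCommGroup F₁] [InnerProductSpace ℝ F₁] [CompleteSpace F₁] [RKHS ℝ F₁ X ℝ]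
    [NormedAddCommGroup G₁] [InnerProductSpace ℝ G₁] [CompleteSpace G₁]
    (S₁ : F₁ →L[ℝ] G₁) (hS₁ : S₁ ≠ 0) (hcompact : IsCompactOperator S₁)
    (W₁ : F₁ →L[ℝ] F₁) (hW₁ : W₁ = ContinuousLinearMap.adjoint S₁ ∘L S₁)
    (hgap : orderedEigenvalue W₁ 2 < orderedEigenvalue W₁ 1)
    (hdecay : 0 < polyDecay (minimalError S₁))
    (η₁ : F₁) (hη₁ : W₁ η₁ = orderedEigenvalue W₁ 1 • η₁) (hη₁_norm : ‖η₁‖ = 1)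
    (hη₁_kernel : ∃ t : X,
      η₁ = (reproKernel F₁ t t) ^ (-(1 / 2) : ℝ) • kernelSection F₁ t ∨
      η₁ = -((reproKernel F₁ t t) ^ (-(1 / 2) : ℝ) • kernelSection F₁ t)) :
    IsQuasiPolynomiallyTractable (fun d : ℕ => tensorPowerOp S₁ d) := by
  subst hW₁
  obtain ⟨hηS, hS'⟩ := spectral_gap hS₁ hcompact hgap hη₁ hη₁_norm
  obtain ⟨t, a, ht⟩ : ∃ (t : X) (a : ℝ), ∀ f : F₁, inner ℝ η₁ f = a * f t := by
    obtain ⟨t, ht⟩ := hη₁_kernel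
    obtain ⟨a, ha⟩ : ∃ a : ℝ, η₁ = a • kernelSection F₁ t := by
      rcases ht with ht | ht
      · exact ⟨_, ht⟩
      · exact ⟨_, ht.trans (neg_smul _ _).symm⟩
    exact ⟨t, a, fun f => by rw [ha, inner_smul_left, inner_kernelSection]; rfl⟩
  obtain ⟨ρ, c, hρ, hc, H⟩ := exists_smolyak hS₁ hη₁_norm hηS hS' ht hdecay
  have hlogρ : 0 < Real.log ρ := Real.log_pos hρ
  have hc' : (1 : ℝ) ≤ c := by exact_mod_cast hc
  have hlogc : 0 ≤ Real.log (2 * c) := Real.log_nonneg (by linarith)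
  refine ⟨Real.exp 1, (1 + 1 / Real.log ρ) * (1 + Real.log (2 * c)), (Real.exp_pos 1).le,
    by positivity, fun ε hε d hd => ?_⟩
  obtain ⟨hε0, hε1⟩ := hε
  have hL : 0 ≤ Real.log ε⁻¹ := Real.log_nonneg ((one_le_inv₀ hε0).2 hε1.le)
  have hd' : (1 : ℝ) ≤ d := by exact_mod_cast hd
  have hlogd : 0 ≤ Real.log d := Real.log_nonneg hd'
  -- The least level with `ρ ^ Q ≥ ε⁻¹`. Then `(2 * c * d) ^ Q = exp (Q * (ln (2 * c) + ln d))` has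
  -- the required form.
  set Q := ⌈Real.log ε⁻¹ / Real.log ρ⌉₊ with hQ
  obtain ⟨N, A, hA, hN, hAe⟩ := H Q d hd
  have hρQ : ε⁻¹ ≤ ρ ^ Q := by
    rw [← Real.log_le_log_iff (inv_pos.2 hε0) (by positivity), Real.log_pow,
      ← div_le_iff₀ hlogρ]
    exact Nat.le_ceil _
  have herr : ‖tensorPowerOp S₁ d - A‖ ≤ ε * ‖tensorPowerOp S₁ d‖ := by
    have h1 : ‖tensorPowerOp S₁ d - A‖ * ε⁻¹ ≤ ‖tensorPowerOp S₁ d‖ := by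
      refine le_trans ?_ hAe
      gcongr
    rwa [← div_eq_mul_inv, div_le_iff₀ hε0, mul_comm] at h1
  have hQ1 : (Q : ℝ) ≤ (1 + 1 / Real.log ρ) * (1 + Real.log ε⁻¹) := by
    have h1 : (Q : ℝ) < Real.log ε⁻¹ / Real.log ρ + 1 := Nat.ceil_lt_add_one (by positivity)
    have h2 : (1 + 1 / Real.log ρ) * (1 + Real.log ε⁻¹) =
        Real.log ε⁻¹ / Real.log ρ + 1 + (1 / Real.log ρ + Real.log ε⁻¹) := by ring
    have h3 : 0 ≤ 1 / Real.log ρ + Real.log ε⁻¹ := by positivity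
    linarith
  have hcost : (N : ℝ) ≤ Real.exp 1 * Real.exp ((1 + 1 / Real.log ρ) * (1 + Real.log (2 * c)) *
      (1 + Real.log ε⁻¹) * (1 + Real.log d)) := by
    refine hN.trans ?_
    gcongr
    have hb : 0 < 2 * (c : ℝ) * d := by positivity
    rw [← Real.exp_log hb, ← Real.exp_nat_mul, Real.log_mul (by positivity) (by positivity)]
    refine Real.exp_le_exp.2 ?_
    calc (Q : ℝ) * (Real.log (2 * c) + Real.log d)
        ≤ ((1 + 1 / Real.log ρ) * (1 + Real.log ε⁻¹)) *
            ((1 + Real.log (2 * c)) * (1 + Real.log d)) := by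
          gcongr
          nlinarith [mul_nonneg hlogc hlogd]
      _ = _ := by ring
  calc (infoComplexity ε (tensorPowerOp S₁ d) : ENNReal) ≤ ((N : ℕ∞) : ENNReal) := by
        exact_mod_cast hA.infoComplexity_le herr
    _ = ENNReal.ofReal N := by simp
    _ ≤ _ := ENNReal.ofReal_le_ofReal hcost
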